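/- Let $\mathbb K$ be $\mathbb R$ or $\mathbb C$. For a Banach algebra $A$ over $\mathbb K$ (not necessarily unital), its dual $A^*$ is a Banach $A$-bimodule through $\langle f\cdot a,b\rangle=\langle f,ab\rangle$ and $\langle a\cdot f,b\rangle=\langle f,ba\rangle$ ($a,b\in A$, $f\in A^*$). - $A$ is a *dual Banach algebra* if there is a norm-closed $A$-submodule $A_*$ of $A^*$ (that is, $f\cdot a,\ a\cdot f\in A_*$ for all $f\in A_*$, $a\in A$) such that $A=(A_*)^*$ as a Banach space, i.e. the canonical map $A\to (A_*)^*$, $a\mapsto (f\mapsto f(a))$, is an isometric bijection. - $f\in A^*$ is *weakly almost periodic* if $\{f\cdot a : a\in A,\ \|a\|\le 1\}$ is relatively compact in the weak topology of the Banach space $A^*$. The weakly almost periodic functionals form a linear subspace $\mathrm{WAP}(A)$ of $A^*$. - $A$ is a *WAP-algebra* if the canonical map $\iota:A\to \mathrm{WAP}(A)^*$, $\iota(a)(f)=f(a)$, is bounded below, i.e. there is $c>0$ with $\|\iota(a)\|\ge c\|a\|$ for all $a\in A$. For a Banach space $E$ over $\mathbb K$ let $B(E)$ be the Banach algebra of bounded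 linear operators on $E$, and let $E\hat\otimes E^*$ be the projective tensor product (the completion of $E\otimes E^*$ in the projective norm), mapped canonically into $B(E)^*$ by the bounded linear map determined by $\langle x\otimes\varphi,T\rangle=\varphi(Tx)$ ($x\in E$, $\varphi\in E^*$, $T\in B(E)$). **Proposition.** Let $E$ be a Banach space over $\mathbb K$. The following statements are equivalent: 1. $B(E)$ is a dual Banach algebra. 2. $B(E)$ is a WAP-algebra. 3. $E\hat\otimes E^*\subseteq \mathrm{WAP}(B(E))$, i.e. the image in $B(E)^*$ of every $\tau\in E\hat\otimes E^*$ is weakly almost periodic. 4. $E$ is reflexive, i.e. the canonical embedding $E\to E^{**}$ is surjective. -/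

import Mathlib

open scoped TensorProduct Topology

noncomputable section

/-! ## Reflexive Banach spaces -/

/-- A normed space is reflexive if the canonical embedding into its double dual is onto. -/
def IsReflexiveSpace (𝕜 E : Type*) [RCLike 𝕜] [NormedAddCommGroup E] [NormedSpace 𝕜 E] : Prop :=
  Function.Surjective (NormedSpace.inclusionInDoubleDual 𝕜 E)

/-- The Banach dual `P*` of a linear subspace `P` of a normed space `X`, where `P` carries the norm
of `X`. -/
abbrev SubDual {𝕜 X : Type*} [RCLike 𝕜] [NormedAddCommGroup X] [NormedSpace 𝕜 X]
    (P : Submodule 𝕜 X) : Type _ :=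
  StrongDual 𝕜 P

/-- For a linear subspace `P` of the dual of `X`, the canonical map `X → P*`, `x ↦ (f ↦ f x)`. -/
def evalOn {𝕜 X : Type*} [RCLike 𝕜] [NormedAddCommGroup X] [NormedSpace 𝕜 X]
    (P : Submodule 𝕜 (StrongDual 𝕜 X)) (x : X) : SubDual P :=
  (NormedSpace.inclusionInDoubleDual 𝕜 X x).comp P.subtypeL

theorem evalOn_apply {𝕜 X : Type*} [RCLike 𝕜] [NormedAddCommGroup X] [NormedSpace 𝕜 X]
    (P : Submodule 𝕜 (StrongDual 𝕜 X)) (x : X) (f : P) :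
    evalOn P x f = (f : StrongDual 𝕜 X) x := rfl

/-! ## Dual Banach algebras and weakly almost periodic functionals

A Banach algebra is not required to have a unit. -/

section BanachAlgebra

variable (𝕜 : Type*) {A : Type*} [RCLike 𝕜] [NonUnitalNormedRing A] [NormedSpace 𝕜 A]
  [IsScalarTower 𝕜 A A] [SMulCommClass 𝕜 A A]

variable {𝕜} in
/-- The right module action of `A` on its dual: `⟨f · a, b⟩ = ⟨f, a b⟩`. -/
def dualActRight (f : StrongDual 𝕜 A) (a : A) : StrongDual 𝕜 A :=
  f.comp (ContinuousLinearMap.mul 𝕜 A a)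

variable {𝕜} in
/-- The left module action of `A` on its dual: `⟨a · f, b⟩ = ⟨f, b a⟩`. -/
def dualActLeft (a : A) (f : StrongDual 𝕜 A) : StrongDual 𝕜 A :=
  f.comp ((ContinuousLinearMap.mul 𝕜 A).flip a)

variable {𝕜} in
theorem dualActRight_apply (f : StrongDual 𝕜 A) (a b : A) : dualActRight f a b = f (a * b) := rfl

variable {𝕜} in
theorem dualActLeft_apply (f : StrongDual 𝕜 A) (a b : A) : dualActLeft a f b = f (b * a) := rfl

variable (A) in
/-- `A` is a dual Banach algebra: there is a closed `A`-submodule `P` (the predual) of the dual of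
`A` such that `A = P*` as a Banach space, i.e. the canonical map `A → P*` is an isometric
bijection. -/
def IsDualBanachAlgebra : Prop :=
  ∃ P : Submodule 𝕜 (StrongDual 𝕜 A),
    IsClosed (P : Set (StrongDual 𝕜 A)) ∧
    (∀ f ∈ P, ∀ a : A, dualActRight f a ∈ P ∧ dualActLeft a f ∈ P) ∧
    Isometry (evalOn P) ∧ Function.Surjective (evalOn P)

variable {𝕜} in
/-- A functional `f` on `A` is weakly almost periodic if `{f · a : ‖a‖ ≤ 1}` is relatively compact
in the weak topology of the dual of `A`. -/
def IsWeaklyAlmostPeriodic (f : StrongDual 𝕜 A) : Prop :=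
  IsCompact (closure
    (toWeakSpace 𝕜 (StrongDual 𝕜 A) '' {g | ∃ a : A, ‖a‖ ≤ 1 ∧ g = dualActRight f a}))

variable (A) in
/-- The space `WAP(A)` of weakly almost periodic functionals, as a subspace of the dual of `A`. -/
def WAP : Submodule 𝕜 (StrongDual 𝕜 A) where
  carrier := {f | IsWeaklyAlmostPeriodic f}
  zero_mem' := by
    have h : (toWeakSpace 𝕜 (StrongDual 𝕜 A) ''
        {g | ∃ a : A, ‖a‖ ≤ 1 ∧ g = dualActRight 0 a}) ⊆ {0} := by
      rintro _ ⟨_, ⟨a, _, rfl⟩, rfl⟩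
      rw [Set.mem_singleton_iff, map_eq_zero_iff _ (LinearEquiv.injective _)]
      rfl
    exact isCompact_singleton.closure_of_subset h
  add_mem' := by
    intro f g hf hg
    refine (hf.add hg).closure_of_subset ?_
    rintro _ ⟨_, ⟨a, ha, rfl⟩, rfl⟩
    exact ⟨_, subset_closure ⟨_, ⟨a, ha, rfl⟩, rfl⟩, _, subset_closure ⟨_, ⟨a, ha, rfl⟩, rfl⟩, rfl⟩
  smul_mem' := by
    intro c f hf
    refine (hf.image (continuous_const_smul c)).closure_of_subset ?_
    rintro _ ⟨_, ⟨a, ha, rfl⟩, rfl⟩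
    exact ⟨_, subset_closure ⟨_, ⟨a, ha, rfl⟩, rfl⟩, rfl⟩

variable (A) in
/-- `A` is a WAP-algebra: the canonical map `A → WAP(A)*` is bounded below. -/
def IsWAPAlgebra : Prop :=
  ∃ c : ℝ, 0 < c ∧ ∀ a : A, c * ‖a‖ ≤ ‖evalOn (WAP 𝕜 A) a‖

end BanachAlgebra

/-! ## The projective tensor product of two normed spaces -/

section Projective

variable (𝕜 E F : Type*) [RCLike 𝕜] [NormedAddCommGroup E] [NormedSpace 𝕜 E]
  [NormedAddCommGroup F] [NormedSpace 𝕜 F]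

/-- The algebraic tensor product, as a type to carry the projective norm. -/
def AlgProj : Type _ := E ⊗[𝕜] F

instance : AddCommGroup (AlgProj 𝕜 E F) := inferInstanceAs (AddCommGroup (E ⊗[𝕜] F))

instance : Module 𝕜 (AlgProj 𝕜 E F) := inferInstanceAs (Module 𝕜 (E ⊗[𝕜] F))

variable {𝕜 E F}

/-- `∑ᵢ xᵢ ⊗ yᵢ` for a finite list of pairs `(xᵢ, yᵢ)`. -/
def AlgProj.ofList (l : List (E × F)) : AlgProj 𝕜 E F :=
  (l.map fun p => (p.1 ⊗ₜ[𝕜] p.2 : E ⊗[𝕜] F)).sum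

/-- `∑ᵢ ‖xᵢ‖ ‖yᵢ‖` for a finite list of pairs `(xᵢ, yᵢ)`. -/
def AlgProj.cost (l : List (E × F)) : ℝ := (l.map fun p => ‖p.1‖ * ‖p.2‖).sum

/-- The projective norm: the infimum of `∑ᵢ ‖xᵢ‖ ‖yᵢ‖` over all finite representations
`u = ∑ᵢ xᵢ ⊗ yᵢ`. -/
def AlgProj.projNorm (u : AlgProj 𝕜 E F) : ℝ :=
  ⨅ l : {l : List (E × F) // AlgProj.ofList l = u}, AlgProj.cost l.1

theorem AlgProj.cost_nonneg (l : List (E × F)) : 0 ≤ AlgProj.cost l := by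
  refine List.sum_nonneg fun r hr => ?_
  obtain ⟨p, _, rfl⟩ := List.mem_map.1 hr
  positivity

theorem AlgProj.bddBelow (u : AlgProj 𝕜 E F) : BddBelow (Set.range
    fun l : {l : List (E × F) // AlgProj.ofList l = u} => AlgProj.cost l.1) :=
  ⟨0, by rintro _ ⟨l, rfl⟩; exact AlgProj.cost_nonneg l.1⟩

theorem AlgProj.ofList_append (l m : List (E × F)) :
    (AlgProj.ofList (l ++ m) : AlgProj 𝕜 E F) = AlgProj.ofList l + AlgProj.ofList m := by
  unfold AlgProj.ofList
  rw [List.map_append, List.sum_append]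
  rfl

theorem AlgProj.ofList_smul (c : 𝕜) (l : List (E × F)) :
    (AlgProj.ofList (l.map fun p => (c • p.1, p.2)) : AlgProj 𝕜 E F) = c • AlgProj.ofList l := by
  unfold AlgProj.ofList
  refine Eq.trans ?_ (List.smul_sum (r := c)
    (l := l.map fun p => (p.1 ⊗ₜ[𝕜] p.2 : E ⊗[𝕜] F))).symm
  simp only [List.map_map, Function.comp_def, TensorProduct.smul_tmul']
  rfl

theorem AlgProj.cost_smul (c : 𝕜) (l : List (E × F)) :
    AlgProj.cost (l.map fun p => (c • p.1, p.2)) = ‖c‖ * AlgProj.cost l := by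
  simp [AlgProj.cost, Function.comp_def, norm_smul, mul_assoc, List.sum_map_mul_left]

theorem AlgProj.exists_ofList (u : AlgProj 𝕜 E F) :
    ∃ l : List (E × F), AlgProj.ofList l = u := by
  refine TensorProduct.induction_on (motive := fun u : E ⊗[𝕜] F =>
    ∃ l : List (E × F), (AlgProj.ofList l : AlgProj 𝕜 E F) = u) u ⟨[], rfl⟩ ?_ ?_
  · intro x y
    exact ⟨[(x, y)], add_zero _⟩
  · rintro _ _ ⟨l, rfl⟩ ⟨m, rfl⟩
    exact ⟨l ++ m, AlgProj.ofList_append l m⟩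

instance (u : AlgProj 𝕜 E F) : Nonempty {l : List (E × F) // AlgProj.ofList l = u} :=
  let ⟨l, hl⟩ := AlgProj.exists_ofList u
  ⟨⟨l, hl⟩⟩

theorem AlgProj.projNorm_le (l : List (E × F)) :
    (AlgProj.ofList l : AlgProj 𝕜 E F).projNorm ≤ AlgProj.cost l :=
  ciInf_le (AlgProj.bddBelow _) ⟨l, rfl⟩

theorem AlgProj.projNorm_zero : (0 : AlgProj 𝕜 E F).projNorm = 0 :=
  le_antisymm (AlgProj.projNorm_le []) (le_ciInf fun l => AlgProj.cost_nonneg l.1)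

theorem AlgProj.projNorm_add_le (u v : AlgProj 𝕜 E F) :
    (u + v).projNorm ≤ u.projNorm + v.projNorm := by
  refine le_ciInf_add_ciInf ?_
  rintro ⟨l, rfl⟩ ⟨m, rfl⟩
  rw [← AlgProj.ofList_append]
  refine (AlgProj.projNorm_le _).trans (le_of_eq ?_)
  simp [AlgProj.cost]

theorem AlgProj.projNorm_smul_le (c : 𝕜) (u : AlgProj 𝕜 E F) :
    (c • u).projNorm ≤ ‖c‖ * u.projNorm := by
  unfold AlgProj.projNorm
  rw [Real.mul_iInf_of_nonneg (norm_nonneg c)]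
  refine le_ciInf ?_
  rintro ⟨l, rfl⟩
  rw [← AlgProj.ofList_smul, ← AlgProj.cost_smul]
  exact AlgProj.projNorm_le _

variable (𝕜 E F) in
/-- The projective norm as a seminorm. -/
def AlgProj.seminorm : Seminorm 𝕜 (AlgProj 𝕜 E F) :=
  .ofSMulLE AlgProj.projNorm AlgProj.projNorm_zero AlgProj.projNorm_add_le AlgProj.projNorm_smul_le

instance : SeminormedAddCommGroup (AlgProj 𝕜 E F) :=
  AddGroupSeminorm.toSeminormedAddCommGroup (AlgProj.seminorm 𝕜 E F).toAddGroupSeminorm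

theorem AlgProj.norm_def (u : AlgProj 𝕜 E F) : ‖u‖ = u.projNorm := rfl

instance : NormedSpace 𝕜 (AlgProj 𝕜 E F) := ⟨AlgProj.projNorm_smul_le⟩

variable (𝕜 E F) in
/-- The projective tensor product `E ⊗̂ F`: the completion of the algebraic tensor product in the
projective norm. -/
abbrev ProjTensor : Type _ := UniformSpace.Completion (AlgProj 𝕜 E F)

variable (𝕜) in
/-- The elementary tensor `x ⊗ y` in `E ⊗̂ F`. -/
def ProjTensor.tmul (x : E) (y : F) : ProjTensor 𝕜 E F :=
  ((AlgProj.ofList [(x, y)] : AlgProj 𝕜 E F) : ProjTensor 𝕜 E F)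

variable {G : Type*} [NormedAddCommGroup G] [NormedSpace 𝕜 G]

/-- The linear map `E ⊗ F → G` induced by a bounded bilinear map. -/
def AlgProj.liftLinear (B : E →L[𝕜] F →L[𝕜] G) : AlgProj 𝕜 E F →ₗ[𝕜] G :=
  TensorProduct.lift (B.toLinearMap₁₂ : E →ₗ[𝕜] F →ₗ[𝕜] G)

theorem AlgProj.liftLinear_ofList (B : E →L[𝕜] F →L[𝕜] G) (l : List (E × F)) :
    AlgProj.liftLinear B (AlgProj.ofList l) = (l.map fun p => B p.1 p.2).sum := by
  refine (map_list_sum (TensorProduct.lift (B.toLinearMap₁₂ : E →ₗ[𝕜] F →ₗ[𝕜] G)) _).trans ?_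
  simp [List.map_map, Function.comp_def]

theorem AlgProj.norm_liftLinear_le (B : E →L[𝕜] F →L[𝕜] G) (u : AlgProj 𝕜 E F) :
    ‖AlgProj.liftLinear B u‖ ≤ ‖B‖ * ‖u‖ := by
  rw [AlgProj.norm_def, AlgProj.projNorm, Real.mul_iInf_of_nonneg (norm_nonneg B)]
  refine le_ciInf ?_
  rintro ⟨l, rfl⟩
  rw [AlgProj.liftLinear_ofList]
  induction l with
  | nil => simp [AlgProj.cost]
  | cons p l ih =>
    have h1 := B.le_opNorm₂ p.1 p.2
    have h2 := norm_add_le (B p.1 p.2) (l.map fun p => B p.1 p.2).sum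
    simp only [AlgProj.cost, List.map_cons, List.sum_cons] at ih ⊢
    linarith [mul_assoc ‖B‖ ‖p.1‖ ‖p.2‖, mul_add ‖B‖ (‖p.1‖ * ‖p.2‖)
      (l.map fun p => ‖p.1‖ * ‖p.2‖).sum]

/-- The bounded linear map `E ⊗̂ F → G` induced by a bounded bilinear map `E × F → G`. -/
def ProjTensor.lift [CompleteSpace G] (B : E →L[𝕜] F →L[𝕜] G) : ProjTensor 𝕜 E F →L[𝕜] G :=
  ((AlgProj.liftLinear B).mkContinuous ‖B‖ (AlgProj.norm_liftLinear_le B)).extend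
    (UniformSpace.Completion.toComplL : AlgProj 𝕜 E F →L[𝕜] ProjTensor 𝕜 E F)

theorem ProjTensor.lift_coe [CompleteSpace G] (B : E →L[𝕜] F →L[𝕜] G) (u : AlgProj 𝕜 E F) :
    ProjTensor.lift B (u : ProjTensor 𝕜 E F) = AlgProj.liftLinear B u :=
  ContinuousLinearMap.extend_eq _ UniformSpace.Completion.denseRange_coe
    (UniformSpace.Completion.isUniformInducing_coe _) u

theorem ProjTensor.lift_tmul [CompleteSpace G] (B : E →L[𝕜] F →L[𝕜] G) (x : E) (y : F) :
    ProjTensor.lift B (ProjTensor.tmul 𝕜 x y) = B x y := by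
  rw [ProjTensor.tmul, ProjTensor.lift_coe, AlgProj.liftLinear_ofList]
  simp

end Projective

/-! ## The functionals on `B(E)` given by `E ⊗̂ E*` -/

section TraceDuality

variable (𝕜 E : Type*) [RCLike 𝕜] [NormedAddCommGroup E] [NormedSpace 𝕜 E]

/-- The bounded bilinear map `(x, φ) ↦ (T ↦ φ (T x))` from `E × E*` to the dual of `B(E)`. -/
def traceBilin : E →L[𝕜] StrongDual 𝕜 E →L[𝕜] StrongDual 𝕜 (E →L[𝕜] E) :=
  ((ContinuousLinearMap.compL 𝕜 (E →L[𝕜] E) E 𝕜).flip).comp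
    (ContinuousLinearMap.apply 𝕜 E)

theorem traceBilin_apply (x : E) (φ : StrongDual 𝕜 E) (T : E →L[𝕜] E) :
    traceBilin 𝕜 E x φ T = φ (T x) := rfl

/-- The canonical map `E ⊗̂ E* → B(E)*`, `⟨∑ₙ xₙ ⊗ φₙ, T⟩ = ∑ₙ φₙ (T xₙ)`. -/
def traceMap : ProjTensor 𝕜 E (StrongDual 𝕜 E) →L[𝕜] StrongDual 𝕜 (E →L[𝕜] E) :=
  ProjTensor.lift (𝕜 := 𝕜) (E := E) (F := StrongDual 𝕜 E) (G := StrongDual 𝕜 (E →L[𝕜] E))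
    (traceBilin 𝕜 E)

theorem traceMap_tmul (x : E) (φ : StrongDual 𝕜 E) (T : E →L[𝕜] E) :
    traceMap 𝕜 E (ProjTensor.tmul 𝕜 x φ) T = φ (T x) := by
  rw [traceMap, ProjTensor.lift_tmul, traceBilin_apply]

end TraceDuality

end

noncomputable section

/-! ### Weak compactness and reflexivity -/

section Reflexivity

variable {𝕜 E : Type*} [RCLike 𝕜] [NormedAddCommGroup E] [NormedSpace 𝕜 E]

/-! Write x ⊗ φ for the functional T ↦ φ(Tx). If E is reflexive, the closed span of these
functionals is a predual of B(E): a functional Λ on it gives x ↦ (φ ↦ Λ(x ⊗ φ)), an operator E → E**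
= E.

Every functional f in a predual P is weakly almost periodic, because a ↦ f · a is weak*-to-weak
continuous and the unit ball of A = P* is weak* compact. Since P already computes the norm of A,
dual Banach algebras are WAP-algebras.

Conversely, let f be weakly almost periodic and nonzero on the rank-one operator z ↦ φ(z)x. Pairing
the orbit of f with the operators z ↦ φ(z)y maps it, up to a scalar, onto a set containing the unit
ball of E*, so that ball lies in a weakly compact set. This forces reflexivity: compactness and
Hahn–Banach put each Λ in E** arbitrarily close to E, which is closed in E**. -/

theorem continuous_weakSpace_eval (Λ : StrongDual 𝕜 E) :
    Continuous fun w : WeakSpace 𝕜 E => Λ ((toWeakSpace 𝕜 E).symm w) :=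
  WeakBilin.eval_continuous (topDualPairing 𝕜 E).flip Λ

/-- If a functional on `E*` has norm at most `ε` on the common kernel of finitely many point
evaluations, then it is within `ε` of a point evaluation. -/
theorem exists_norm_sub_inclusionInDoubleDual_le {ε : ℝ} (hε : 0 ≤ ε)
    (Λ : StrongDual 𝕜 (StrongDual 𝕜 E)) (F : Finset E)
    (hF : ∀ g : StrongDual 𝕜 E, ‖g‖ = 1 → (∀ y ∈ F, g y = 0) → ‖Λ g‖ ≤ ε) :
    ∃ x : E, ‖Λ - NormedSpace.inclusionInDoubleDual 𝕜 E x‖ ≤ ε := by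
  let L : F → StrongDual 𝕜 E →ₗ[𝕜] 𝕜 := fun y =>
    (NormedSpace.inclusionInDoubleDual 𝕜 E y : StrongDual 𝕜 E →ₗ[𝕜] 𝕜)
  let N : Submodule 𝕜 (StrongDual 𝕜 E) := ⨅ y, LinearMap.ker (L y)
  have hN : ∀ g : StrongDual 𝕜 E, g ∈ N ↔ ∀ y ∈ F, g y = 0 := by
    intro g
    simp [N, L]
  -- Hahn–Banach extends Λ restricted to N to a small Λ'. Then Λ - Λ' kills N, a finite intersection
  -- of kernels, so it is a combination of the evaluations.
  obtain ⟨Λ', hΛ', hnorm⟩ := exists_extension_norm_eq N (Λ.comp N.subtypeL)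
  have hle : ‖Λ'‖ ≤ ε := by
    rw [hnorm]
    refine ContinuousLinearMap.opNorm_le_of_unit_norm hε fun g hg => ?_
    exact hF g hg ((hN g).1 g.2)
  have hmem : ((Λ - Λ' : StrongDual 𝕜 (StrongDual 𝕜 E)) : StrongDual 𝕜 E →ₗ[𝕜] 𝕜) ∈
      Submodule.span 𝕜 (Set.range L) := by
    refine mem_span_of_iInf_ker_le_ker fun g hg => ?_
    have := hΛ' ⟨g, hg⟩
    simp only [ContinuousLinearMap.comp_apply, Submodule.subtypeL_apply] at this
    simp [this]
  obtain ⟨c, hc⟩ := (Submodule.mem_span_range_iff_exists_fun 𝕜).1 hmem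
  refine ⟨∑ y, c y • (y : E), ?_⟩
  have : Λ - NormedSpace.inclusionInDoubleDual 𝕜 E (∑ y, c y • (y : E)) = Λ' := by
    ext g
    have := LinearMap.congr_fun hc g
    simp only [L, LinearMap.sum_apply, LinearMap.smul_apply, ContinuousLinearMap.coe_coe,
      NormedSpace.dual_def, sub_apply] at this
    have hg : NormedSpace.inclusionInDoubleDual 𝕜 E (∑ y, c y • (y : E)) g = Λ g - Λ' g := by
      rw [NormedSpace.dual_def, map_sum, ← this]
      exact Finset.sum_congr rfl fun y _ => map_smul g (c y) (y : E)
    rw [sub_apply, hg, sub_sub_cancel]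
  rwa [this]

/-- A Banach space is reflexive if the unit ball of its dual is contained in a weakly compact
set. -/
theorem isReflexiveSpace_of_isCompact [CompleteSpace E] {K : Set (WeakSpace 𝕜 (StrongDual 𝕜 E))}
    (hK : IsCompact K) (hball : ∀ g : StrongDual 𝕜 E, ‖g‖ ≤ 1 → toWeakSpace 𝕜 _ g ∈ K) :
    IsReflexiveSpace 𝕜 E := by
  intro Λ
  have hiso : Isometry (NormedSpace.inclusionInDoubleDual 𝕜 E) :=
    (NormedSpace.inclusionInDoubleDualLi (E := E) 𝕜).isometry
  have hcl : IsClosed (Set.range (NormedSpace.inclusionInDoubleDual 𝕜 E)) :=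
    hiso.isClosedEmbedding.isClosed_range
  change Λ ∈ Set.range (NormedSpace.inclusionInDoubleDual 𝕜 E)
  rw [← hcl.closure_eq]
  refine (Metric.mem_closure_iff (α := StrongDual 𝕜 (StrongDual 𝕜 E))).2 fun ε hε => ?_
  have hC : IsCompact (K ∩ {w | ε / 2 ≤ ‖Λ ((toWeakSpace 𝕜 _).symm w)‖}) :=
    hK.inter_right (isClosed_le continuous_const (continuous_weakSpace_eval Λ).norm)
  -- Zero is not in this compact set, so each member is nonzero at some y; finitely many y suffice.
  obtain ⟨F, hF⟩ := hC.elim_finite_subcover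
    (fun y : E => {w | ((toWeakSpace 𝕜 (StrongDual 𝕜 E)).symm w) y ≠ 0})
    (fun y => isOpen_ne_fun
      (continuous_weakSpace_eval (NormedSpace.inclusionInDoubleDual 𝕜 E y)) continuous_const)
    (by
      rintro w ⟨-, hw⟩
      by_contra h
      simp only [Set.mem_iUnion, Set.mem_ofPred_eq, not_exists, not_not] at h
      have h0 : (toWeakSpace 𝕜 (StrongDual 𝕜 E)).symm w = 0 := ContinuousLinearMap.ext h
      rw [Set.mem_ofPred_eq, h0, map_zero, norm_zero] at hw
      linarith)
  obtain ⟨x, hx⟩ := exists_norm_sub_inclusionInDoubleDual_le (half_pos hε).le Λ F (by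
    intro g hg hgF
    by_contra! h
    have := hF ⟨hball g hg.le, h.le⟩
    simp only [Set.mem_iUnion] at this
    obtain ⟨y, hy, hne⟩ := this
    exact hne (hgF y hy))
  refine ⟨_, ⟨x, rfl⟩, ?_⟩
  exact (dist_eq_norm_sub Λ _).trans_lt (hx.trans_lt (half_lt_self hε))

theorem isReflexiveSpace_of_subsingleton [Subsingleton E] : IsReflexiveSpace 𝕜 E := fun Λ =>
  ⟨0, ContinuousLinearMap.ext fun g => by
    rw [show g = 0 from ContinuousLinearMap.ext fun x => by rw [Subsingleton.elim x 0, map_zero,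
      map_zero], map_zero, map_zero]⟩

/-- If some weakly almost periodic functional on `B(E)` does not vanish on a rank-one operator,
then `E` is reflexive. -/
theorem isReflexiveSpace_of_mem_WAP [CompleteSpace E] {f : StrongDual 𝕜 (E →L[𝕜] E)}
    (hf : f ∈ WAP 𝕜 (E →L[𝕜] E)) (x : E) (φ : StrongDual 𝕜 E) (hne : f (φ.smulRight x) ≠ 0) :
    IsReflexiveSpace 𝕜 E := by
  have hx : ‖x‖ ≠ 0 := by
    rintro h
    rw [norm_eq_zero] at h
    simp [h] at hne
  have hx' : ((‖x‖ : ℝ) : 𝕜) ≠ 0 := by exact_mod_cast hx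
  let S : E →L[𝕜] E →L[𝕜] E := ContinuousLinearMap.smulRightL 𝕜 E E φ
  -- With the unit vector x/‖x‖, the operator z ↦ g(z)x/‖x‖ has norm ‖g‖. Its product with `S y` is
  -- g(y)/‖x‖ times the original rank-one operator; the scalar in `T` undoes the resulting factor.
  let T : StrongDual 𝕜 (E →L[𝕜] E) →L[𝕜] StrongDual 𝕜 E :=
    (‖x‖ * (f (φ.smulRight x))⁻¹ : 𝕜) • (ContinuousLinearMap.compL 𝕜 E (E →L[𝕜] E) 𝕜).flip S
  have hK : IsCompact _ := hf
  refine isReflexiveSpace_of_isCompact (hK.image (WeakSpace.map T).continuous) fun g hg => ?_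
  refine ⟨_, subset_closure ⟨_, ⟨g.smulRight ((‖x‖⁻¹ : 𝕜) • x), ?_, rfl⟩, rfl⟩, ?_⟩
  · rw [ContinuousLinearMap.norm_smulRight_apply, norm_smul, norm_inv, RCLike.norm_ofReal,
      abs_norm, inv_mul_cancel₀ hx, mul_one]
    exact hg
  · change T (dualActRight f _) = g
    ext y
    have : g.smulRight ((‖x‖⁻¹ : 𝕜) • x) * S y = (g y * (‖x‖⁻¹ : 𝕜)) • φ.smulRight x := by
      ext z
      simp [S, smul_smul]
      ring_nf
    change (‖x‖ * (f (φ.smulRight x))⁻¹ : 𝕜) * f (g.smulRight ((‖x‖⁻¹ : 𝕜) • x) * S y) = g y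
    rw [this, map_smul, smul_eq_mul]
    field_simp

end Reflexivity

/-! ### Preduals consist of weakly almost periodic functionals -/

section DualAlgebra

variable {𝕜 A : Type*} [RCLike 𝕜] [NonUnitalNormedRing A] [NormedSpace 𝕜 A]
  [IsScalarTower 𝕜 A A] [SMulCommClass 𝕜 A A]

/-- The elements of a predual of a dual Banach algebra are weakly almost periodic. -/
theorem predual_le_WAP {P : Submodule 𝕜 (StrongDual 𝕜 A)}
    (hP : ∀ f ∈ P, ∀ a : A, dualActRight f a ∈ P ∧ dualActLeft a f ∈ P)
    (hiso : Isometry (evalOn P)) (hsurj : Function.Surjective (evalOn P)) : P ≤ WAP 𝕜 A := by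
  intro f hf
  choose r hr using hsurj
  have hr' : ∀ a, r (evalOn P a) = a := fun a => hiso.injective (hr _)
  let q : WeakDual 𝕜 P → WeakSpace 𝕜 (StrongDual 𝕜 A) := fun w =>
    toWeakSpace 𝕜 _ (dualActRight f (r (WeakDual.toStrongDual w)))
  have hq : Continuous q := by
    refine WeakBilin.continuous_of_continuous_eval _ fun Λ => ?_
    -- On P, Λ is evaluation at some b in A, so Λ(f · a) = f(ab) = (b · f)(a), which is weak*
    -- continuous in a because b · f lies in P.
    have key : ∀ w : WeakDual 𝕜 P, Λ (dualActRight f (r (WeakDual.toStrongDual w))) =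
        w ⟨dualActLeft (r (Λ.comp P.subtypeL)) f, (hP f hf _).2⟩ := by
      intro w
      have h1 := congrArg (fun u : SubDual P => u ⟨dualActRight f (r (WeakDual.toStrongDual w)),
        (hP f hf _).1⟩) (hr (Λ.comp P.subtypeL))
      have h2 := congrArg (fun u : SubDual P => u ⟨dualActLeft (r (Λ.comp P.subtypeL)) f,
        (hP f hf _).2⟩) (hr (WeakDual.toStrongDual w))
      exact h1.symm.trans h2
    exact (WeakDual.eval_continuous _).congr fun w => (key w).symm
  refine ((WeakDual.isCompact_closedBall (𝕜 := 𝕜) (E := P) 0 1).image hq).closure_of_subset ?_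
  rintro _ ⟨_, ⟨a, ha, rfl⟩, rfl⟩
  refine ⟨StrongDual.toWeakDual (evalOn P a), ?_, ?_⟩
  · change evalOn P a ∈ Metric.closedBall 0 1
    have h0 : evalOn P (0 : A) = 0 := by simp [evalOn]
    rw [Metric.mem_closedBall, ← h0, hiso.dist_eq, dist_zero_right]
    exact ha
  · change toWeakSpace 𝕜 _ (dualActRight f (r (evalOn P a))) = _
    rw [hr']

theorem IsDualBanachAlgebra.isWAPAlgebra (h : IsDualBanachAlgebra 𝕜 A) : IsWAPAlgebra 𝕜 A := by
  obtain ⟨P, -, hP, hiso, hsurj⟩ := h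
  have hle := predual_le_WAP hP hiso hsurj
  refine ⟨1, one_pos, fun a => ?_⟩
  have hnorm : ‖evalOn P a‖ = ‖a‖ := by
    simpa [dist_eq_norm, evalOn] using hiso.dist_eq a 0
  rw [one_mul, ← hnorm]
  refine ContinuousLinearMap.opNorm_le_bound _ (ContinuousLinearMap.opNorm_nonneg _) fun f => ?_
  exact (evalOn (WAP 𝕜 A) a).le_opNorm ⟨f, hle f.2⟩

end DualAlgebra

/-! ### The predual of B(E) for reflexive E -/

section TracePredual

variable (𝕜 E : Type*) [RCLike 𝕜] [NormedAddCommGroup E] [NormedSpace 𝕜 E]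

/-- The closed linear span of the functionals `T ↦ φ (T x)` on `B(E)`. -/
def tracePredual : Submodule 𝕜 (StrongDual 𝕜 (E →L[𝕜] E)) :=
  (Submodule.span 𝕜 {f | ∃ x φ, f = traceBilin 𝕜 E x φ}).topologicalClosure

variable {𝕜 E}

theorem traceBilin_mem_tracePredual (x : E) (φ : StrongDual 𝕜 E) :
    traceBilin 𝕜 E x φ ∈ tracePredual 𝕜 E :=
  Submodule.le_topologicalClosure _ (Submodule.subset_span ⟨x, φ, rfl⟩)

theorem isClosed_tracePredual : IsClosed (tracePredual 𝕜 E : Set (StrongDual 𝕜 (E →L[𝕜] E))) :=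
  Submodule.isClosed_topologicalClosure _

theorem tracePredual_le {Q : Submodule 𝕜 (StrongDual 𝕜 (E →L[𝕜] E))}
    (hQ : IsClosed (Q : Set (StrongDual 𝕜 (E →L[𝕜] E))))
    (h : ∀ x φ, traceBilin 𝕜 E x φ ∈ Q) : tracePredual 𝕜 E ≤ Q :=
  Submodule.topologicalClosure_minimal _
    (Submodule.span_le.2 (by rintro _ ⟨x, φ, rfl⟩; exact h x φ)) hQ

/-- Both actions are norm continuous in f, so generators suffice: (x ⊗ φ) · a = x ⊗ (φ ∘ a) and a ·
(x ⊗ φ) = ax ⊗ φ. -/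
theorem dualAct_mem_tracePredual {f : StrongDual 𝕜 (E →L[𝕜] E)} (hf : f ∈ tracePredual 𝕜 E)
    (a : E →L[𝕜] E) :
    dualActRight f a ∈ tracePredual 𝕜 E ∧ dualActLeft a f ∈ tracePredual 𝕜 E := by
  constructor
  · let R : StrongDual 𝕜 (E →L[𝕜] E) →L[𝕜] StrongDual 𝕜 (E →L[𝕜] E) :=
      (ContinuousLinearMap.compL 𝕜 _ _ 𝕜).flip (ContinuousLinearMap.mul 𝕜 (E →L[𝕜] E) a)
    exact tracePredual_le (Q := (tracePredual 𝕜 E).comap R.toLinearMap)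
      (isClosed_tracePredual.preimage R.continuous)
      (fun x φ => traceBilin_mem_tracePredual x (φ.comp a)) hf
  · let R : StrongDual 𝕜 (E →L[𝕜] E) →L[𝕜] StrongDual 𝕜 (E →L[𝕜] E) :=
      (ContinuousLinearMap.compL 𝕜 _ _ 𝕜).flip ((ContinuousLinearMap.mul 𝕜 (E →L[𝕜] E)).flip a)
    exact tracePredual_le (Q := (tracePredual 𝕜 E).comap R.toLinearMap)
      (isClosed_tracePredual.preimage R.continuous)
      (fun x φ => traceBilin_mem_tracePredual (a x) φ) hf

theorem norm_traceBilin_le (x : E) (φ : StrongDual 𝕜 E) : ‖traceBilin 𝕜 E x φ‖ ≤ ‖x‖ * ‖φ‖ :=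
  ContinuousLinearMap.opNorm_le_bound _ (by positivity) fun T => by
    calc ‖φ (T x)‖ ≤ ‖φ‖ * (‖T‖ * ‖x‖) := φ.le_opNorm_of_le (T.le_opNorm x)
      _ = ‖x‖ * ‖φ‖ * ‖T‖ := by ring

/-- The functionals x ⊗ φ alone recover ‖T‖, by Hahn–Banach applied to Tx; reflexivity plays no
role. -/
theorem norm_evalOn_tracePredual (T : E →L[𝕜] E) : ‖evalOn (tracePredual 𝕜 E) T‖ = ‖T‖ := by
  refine le_antisymm (ContinuousLinearMap.opNorm_le_bound _ (ContinuousLinearMap.opNorm_nonneg _) fun f => ?_)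
    (T.opNorm_le_bound (ContinuousLinearMap.opNorm_nonneg _) fun x => ?_)
  · rw [mul_comm]
    exact (f : StrongDual 𝕜 (E →L[𝕜] E)).le_opNorm T
  · refine NormedSpace.norm_le_dual_bound 𝕜 _ (by positivity) fun φ => ?_
    rw [mul_assoc]
    exact (evalOn (tracePredual 𝕜 E) T).le_opNorm_of_le
      (x := ⟨_, traceBilin_mem_tracePredual x φ⟩) (norm_traceBilin_le x φ)

theorem isometry_evalOn_tracePredual : Isometry (evalOn (tracePredual 𝕜 E)) := by
  refine Isometry.of_dist_eq fun S T => ?_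
  rw [dist_eq_norm, dist_eq_norm, ← norm_evalOn_tracePredual (S - T)]
  congr 1
  ext f
  simp [evalOn_apply]

theorem IsReflexiveSpace.surjective_evalOn_tracePredual (h : IsReflexiveSpace 𝕜 E) :
    Function.Surjective (evalOn (tracePredual 𝕜 E)) := by
  intro Λ
  let J : E ≃ₗᵢ[𝕜] StrongDual 𝕜 (StrongDual 𝕜 E) :=
    LinearIsometryEquiv.ofSurjective (NormedSpace.inclusionInDoubleDualLi 𝕜) h
  obtain ⟨Λ', hΛ', -⟩ := exists_extension_norm_eq _ Λ
  let B : E →L[𝕜] StrongDual 𝕜 (StrongDual 𝕜 E) :=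
    (ContinuousLinearMap.compL 𝕜 _ _ 𝕜 Λ').comp (traceBilin 𝕜 E)
  -- Reflexivity enters here: it pulls B x in E** back to a vector of E.
  let T : E →L[𝕜] E := (J.symm.toContinuousLinearEquiv : _ →L[𝕜] E).comp B
  have hT : ∀ x φ, φ (T x) = Λ' (traceBilin 𝕜 E x φ) := fun x φ =>
    congrArg (fun u : StrongDual 𝕜 (StrongDual 𝕜 E) => u φ) (J.apply_symm_apply (B x))
  refine ⟨T, ContinuousLinearMap.ext fun f => ?_⟩
  rw [← hΛ' f]
  let D : StrongDual 𝕜 (StrongDual 𝕜 (E →L[𝕜] E)) :=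
    NormedSpace.inclusionInDoubleDual 𝕜 (E →L[𝕜] E) T - Λ'
  -- D vanishes on the generators and has closed kernel.
  have hD : (f : StrongDual 𝕜 (E →L[𝕜] E)) ∈ LinearMap.ker (D : _ →ₗ[𝕜] 𝕜) :=
    tracePredual_le D.isClosed_ker (fun x φ => sub_eq_zero.2 (hT x φ)) f.2
  exact sub_eq_zero.1 hD

theorem traceMap_mem_tracePredual (τ : ProjTensor 𝕜 E (StrongDual 𝕜 E)) :
    traceMap 𝕜 E τ ∈ tracePredual 𝕜 E := by
  induction τ using UniformSpace.Completion.induction_on with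
  | hp => exact isClosed_tracePredual.preimage (traceMap 𝕜 E).continuous
  | ih u =>
    obtain ⟨l, rfl⟩ := AlgProj.exists_ofList u
    rw [traceMap, ProjTensor.lift_coe, AlgProj.liftLinear_ofList]
    refine list_sum_mem fun f hf => ?_
    obtain ⟨p, -, rfl⟩ := List.mem_map.1 hf
    exact traceBilin_mem_tracePredual p.1 p.2

theorem IsReflexiveSpace.tracePredual_le_WAP (h : IsReflexiveSpace 𝕜 E) :
    tracePredual 𝕜 E ≤ WAP 𝕜 (E →L[𝕜] E) :=
  predual_le_WAP (fun _ hf a => dualAct_mem_tracePredual hf a) isometry_evalOn_tracePredual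
    h.surjective_evalOn_tracePredual

theorem IsReflexiveSpace.isDualBanachAlgebra (h : IsReflexiveSpace 𝕜 E) :
    IsDualBanachAlgebra 𝕜 (E →L[𝕜] E) :=
  ⟨tracePredual 𝕜 E, isClosed_tracePredual, fun _ hf a => dualAct_mem_tracePredual hf a,
    isometry_evalOn_tracePredual, h.surjective_evalOn_tracePredual⟩

end TracePredual

/-! ### From weakly almost periodic functionals back to reflexivity -/

/-- A nontrivial normed space has a vector and a functional with `φ x = 1`. -/
theorem exists_strongDual_apply_eq_one (𝕜 E : Type*) [RCLike 𝕜] [NormedAddCommGroup E]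
    [NormedSpace 𝕜 E] [Nontrivial E] : ∃ (x : E) (φ : StrongDual 𝕜 E), φ x = 1 := by
  obtain ⟨x, hx⟩ := exists_ne (0 : E)
  obtain ⟨φ, -, hφ⟩ := exists_dual_vector 𝕜 x (norm_ne_zero_iff.2 hx)
  have hx' : ((‖x‖ : ℝ) : 𝕜) ≠ 0 := by exact_mod_cast norm_ne_zero_iff.2 hx
  exact ⟨(‖x‖⁻¹ : 𝕜) • x, φ, by simp [hφ, hx']⟩

theorem IsWAPAlgebra.isReflexiveSpace {𝕜 E : Type*} [RCLike 𝕜] [NormedAddCommGroup E]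
    [NormedSpace 𝕜 E] [CompleteSpace E] (h : IsWAPAlgebra 𝕜 (E →L[𝕜] E)) :
    IsReflexiveSpace 𝕜 E := by
  cases subsingleton_or_nontrivial E
  · exact isReflexiveSpace_of_subsingleton
  obtain ⟨c, hc, hle⟩ := h
  obtain ⟨x, φ, hφ⟩ := exists_strongDual_apply_eq_one 𝕜 E
  by_contra hE
  -- Without reflexivity, every weakly almost periodic functional vanishes on rank-one operators, so
  -- the canonical map is not even injective.
  have hzero : evalOn (WAP 𝕜 (E →L[𝕜] E)) (φ.smulRight x) = 0 := by
    ext f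
    by_contra hne
    exact hE (isReflexiveSpace_of_mem_WAP f.2 x φ hne)
  have hn := hle (φ.smulRight x)
  rw [hzero, ContinuousLinearMap.opNorm_zero] at hn
  have h0 : φ.smulRight x = 0 := by
    rw [← norm_le_zero_iff]
    exact nonpos_of_mul_nonpos_right hn hc
  have h1 : φ (φ.smulRight x x) = 1 := by simp [hφ]
  simp [h0] at h1

theorem isReflexiveSpace_of_traceMap_mem_WAP {𝕜 E : Type*} [RCLike 𝕜] [NormedAddCommGroup E]
    [NormedSpace 𝕜 E] [CompleteSpace E]
    (h : ∀ τ : ProjTensor 𝕜 E (StrongDual 𝕜 E), traceMap 𝕜 E τ ∈ WAP 𝕜 (E →L[𝕜] E)) :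
    IsReflexiveSpace 𝕜 E := by
  cases subsingleton_or_nontrivial E
  · exact isReflexiveSpace_of_subsingleton
  obtain ⟨x, φ, hφ⟩ := exists_strongDual_apply_eq_one 𝕜 E
  -- The value of x ⊗ φ at z ↦ φ(z)x is φ(x)² = 1.
  refine isReflexiveSpace_of_mem_WAP (h (ProjTensor.tmul 𝕜 x φ)) x φ ?_
  rw [traceMap_tmul]
  simp [hφ]

end

theorem proposition2p4 (𝕜 E : Type*) [RCLike 𝕜] [NormedAddCommGroup E] [NormedSpace 𝕜 E]
    [CompleteSpace E] :
    List.TFAE [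
      IsDualBanachAlgebra 𝕜 (E →L[𝕜] E),
      IsWAPAlgebra 𝕜 (E →L[𝕜] E),
      ∀ τ : ProjTensor 𝕜 E (StrongDual 𝕜 E), traceMap 𝕜 E τ ∈ WAP 𝕜 (E →L[𝕜] E),
      IsReflexiveSpace 𝕜 E] := by
  tfae_have 1 → 2 := IsDualBanachAlgebra.isWAPAlgebra
  tfae_have 2 → 4 := IsWAPAlgebra.isReflexiveSpace
  tfae_have 4 → 1 := IsReflexiveSpace.isDualBanachAlgebra
  tfae_have 4 → 3 := fun h τ => h.tracePredual_le_WAP (traceMap_mem_tracePredual τ)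
  tfae_have 3 → 4 := isReflexiveSpace_of_traceMap_mem_WAP
  tfae_finish
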